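/- Let $p\in L_\infty[0,1]$ and $r\in L_1[0,1]$ be real-valued with $p>0$ and $r>0$ almost everywhere and $1/p\in L_\infty[0,1]$, and let $\kappa>0$, $\alpha\ge 0$, $\beta>0$ be real numbers. Consider the complex Sobolev spaces $$D_1=\{u\in W_2^1[0,1]: u(0)=0\},\qquad D=\{u\in W_2^2[0,1]: u(0)=u'(0)=0\},$$ the space $D^*$ of continuous antilinear functionals on $D$, the bijective integration operator $Q\colon D_1\to D$, $(Qy)(x)=\int_0^x y\,dt$, and the linear operator pencil $\tilde T\colon\mathbb C\to\mathcal B(D,D^*)$, $$\langle\tilde T(\lambda)u,v\rangle=\int_0^1 p\,u''\,\overline{v''}\,dx+\kappa\,u'(1)\overline{v'(1)}-\lambda\left[\int_0^1 r\,u\,\overline v\,dx+\alpha\,u'(1)\overline{v'(1)}+\beta\,u(1)\overline{v(1)}\right].$$ Then $\tilde T(0)\colon D\to D^*$ has a bounded inverse, the operator $K=-Q^{-1}[\tilde T(0)]^{-1}\tilde T'(0)Q$ on $D_1$ is compact, and $K$ does not increase the number of sign changes of any real function: for every real-valued $u\in D_1$ the function $Ku$ is real-valued and has at most as many sign changes on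 $[0,1]$ as $u$. Here the number of sign changes of a real function $f$ on $[0,1]$ is the supremum (in $\{0,1,2,\dots,\infty\}$) of the $n$ for which there exist points $x_0<x_1<\dots<x_n$ in $[0,1]$ with $f(x_{i-1})f(x_i)<0$ for $i=1,\dots,n$. -/

import Mathlib

open MeasureTheory Set
open scoped ENNReal ComplexConjugate

namespace BeamPencil

noncomputable section

/-- The complex space `L_2[0,1]`. -/
abbrev L2 : Type := Lp ℂ 2 (volume : Measure unitInterval)

theorem integrable_L2 (g : L2) : Integrable (fun t => g t) (volume : Measure unitInterval) :=
  (Lp.memLp g).integrable (by norm_num)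

theorem integrable_C (f : C(unitInterval, ℂ)) :
    Integrable (fun t => f t) (volume : Measure unitInterval) :=
  f.continuous.integrable_of_hasCompactSupport (HasCompactSupport.of_compactSpace _)

theorem setIntegral_L2_add (g h : L2) (s : Set unitInterval) :
    ∫ t in s, (g + h : L2) t = (∫ t in s, g t) + ∫ t in s, h t := by
  rw [← integral_add (integrable_L2 g).integrableOn (integrable_L2 h).integrableOn]
  refine integral_congr_ae (ae_restrict_of_ae ?_)
  filter_upwards [Lp.coeFn_add g h] with t ht
  rw [ht, Pi.add_apply]

theorem setIntegral_L2_smul (c : ℂ) (g : L2) (s : Set unitInterval) :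
    ∫ t in s, (c • g : L2) t = c * ∫ t in s, g t := by
  rw [← integral_const_mul]
  refine integral_congr_ae (ae_restrict_of_ae ?_)
  filter_upwards [Lp.coeFn_smul c g] with t ht
  rw [ht, Pi.smul_apply, smul_eq_mul]

/-- The Sobolev space `W_2^1[0,1]`: pairs `(u, u')` of a continuous function `u` and a class
`u' ∈ L_2[0,1]` such that `u(x) = u(0) + ∫_0^x u'` for all `x`, that is, `u` is absolutely continuous
with derivative `u' ∈ L_2[0,1]` (the class `u'` is determined by `u`).  The norm inherited from the
product, `max (sup |u|) ‖u'‖_{L_2}`, is equivalent to the usual norm of `W_2^1[0,1]`. -/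
def W21 : Submodule ℂ (C(unitInterval, ℂ) × L2) where
  carrier := {u | ∀ x : unitInterval, u.1 x = u.1 0 + ∫ t in Iic x, u.2 t}
  zero_mem' := by
    intro x
    have h := setIntegral_L2_smul 0 0 (Iic x)
    simp only [smul_zero, zero_mul] at h
    simp only [Prod.fst_zero, Prod.snd_zero, ContinuousMap.zero_apply, zero_add]
    exact h.symm
  add_mem' := by
    intro u v hu hv x
    have h := setIntegral_L2_add u.2 v.2 (Iic x)
    simp only [Prod.fst_add, Prod.snd_add, ContinuousMap.add_apply]
    rw [h, hu x, hv x]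
    ring
  smul_mem' := by
    intro c u hu x
    have h := setIntegral_L2_smul c u.2 (Iic x)
    simp only [Prod.smul_fst, Prod.smul_snd, ContinuousMap.smul_apply, smul_eq_mul]
    rw [h, hu x]
    ring

/-- The Sobolev space `W_2^2[0,1]`: triples `(u, u', u'')` where `u` is a continuous function,
`(u', u'') ∈ W_2^1[0,1]`, and `u(x) = u(0) + ∫_0^x u'` for all `x`.  The norm inherited from the product,
`max (sup |u|) (max (sup |u'|) ‖u''‖_{L_2})`, is equivalent to the usual norm of `W_2^2[0,1]`. -/
def W22 : Submodule ℂ (C(unitInterval, ℂ) × C(unitInterval, ℂ) × L2) where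
  carrier := {u | u.2 ∈ W21 ∧ ∀ x : unitInterval, u.1 x = u.1 0 + ∫ t in Iic x, u.2.1 t}
  zero_mem' := ⟨W21.zero_mem, fun x => by simp⟩
  add_mem' := by
    intro u v hu hv
    refine ⟨W21.add_mem hu.1 hv.1, fun x => ?_⟩
    have h := integral_add (μ := volume.restrict (Iic x)) (integrable_C u.2.1).integrableOn
      (integrable_C v.2.1).integrableOn
    simp only [Prod.fst_add, Prod.snd_add, ContinuousMap.add_apply]
    rw [h, hu.2 x, hv.2 x]
    ring
  smul_mem' := by
    intro c u hu
    refine ⟨W21.smul_mem c hu.1, fun x => ?_⟩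
    simp only [Prod.smul_fst, Prod.smul_snd, ContinuousMap.smul_apply, smul_eq_mul]
    rw [integral_const_mul, hu.2 x]
    ring

/-- The space `D_1 = {u ∈ W_2^1[0,1] : u(0) = 0}`, as a subspace. -/
def D1Sub : Submodule ℂ (C(unitInterval, ℂ) × L2) where
  carrier := {u | u ∈ W21 ∧ u.1 0 = 0}
  zero_mem' := ⟨W21.zero_mem, rfl⟩
  add_mem' := by
    intro u v hu hv
    exact ⟨W21.add_mem hu.1 hv.1, by simp [hu.2, hv.2]⟩
  smul_mem' := by
    intro c u hu
    exact ⟨W21.smul_mem c hu.1, by simp [hu.2]⟩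

/-- The space `D = {u ∈ W_2^2[0,1] : u(0) = u'(0) = 0}`, as a subspace. -/
def DSub : Submodule ℂ (C(unitInterval, ℂ) × C(unitInterval, ℂ) × L2) where
  carrier := {u | u ∈ W22 ∧ u.1 0 = 0 ∧ u.2.1 0 = 0}
  zero_mem' := ⟨W22.zero_mem, rfl, rfl⟩
  add_mem' := by
    intro u v hu hv
    exact ⟨W22.add_mem hu.1 hv.1, by simp [hu.2.1, hv.2.1], by simp [hu.2.2, hv.2.2]⟩
  smul_mem' := by
    intro c u hu
    exact ⟨W22.smul_mem c hu.1, by simp [hu.2.1], by simp [hu.2.2]⟩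

/-- The space `D_1 = {u ∈ W_2^1[0,1] : u(0) = 0}` as a normed space. -/
def D1 : Type := ↥D1Sub

instance : NormedAddCommGroup D1 := inferInstanceAs (NormedAddCommGroup ↥D1Sub)

instance : NormedSpace ℂ D1 := inferInstanceAs (NormedSpace ℂ ↥D1Sub)

/-- The space `D = {u ∈ W_2^2[0,1] : u(0) = u'(0) = 0}` as a normed space. -/
def D : Type := ↥DSub

instance : NormedAddCommGroup D := inferInstanceAs (NormedAddCommGroup ↥DSub)

instance : NormedSpace ℂ D := inferInstanceAs (NormedSpace ℂ ↥DSub)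

/-- The function underlying an element of `D_1`. -/
def D1fn (u : D1) : C(unitInterval, ℂ) := u.1.1

/-- The function `u` underlying an element `u` of `D`. -/
def Dfn (u : D) : C(unitInterval, ℂ) := u.1.1

/-- The derivative `u'` of an element `u` of `D`. -/
def Dd1 (u : D) : C(unitInterval, ℂ) := u.1.2.1

/-- The second derivative `u''` of an element `u` of `D`. -/
def Dd2 (u : D) : L2 := u.1.2.2

/-- The primitive `x ↦ ∫_0^x f` of a continuous function `f`. -/
def primitive (f : C(unitInterval, ℂ)) : C(unitInterval, ℂ) where
  toFun x := ∫ t in Iic x, f t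
  continuous_toFun := by
    have h : ∀ x : unitInterval,
        ∫ t in Iic x, f t = ∫ t, (Iic x).indicator (fun t => f t) t := fun x =>
      (integral_indicator measurableSet_Iic).symm
    simp_rw [h]
    rw [continuous_iff_continuousAt]
    intro x
    refine continuousAt_of_dominated (bound := fun t => ‖f t‖) ?_ ?_ (integrable_C f).norm ?_
    · exact Filter.Eventually.of_forall fun y =>
        (integrable_C f).aestronglyMeasurable.indicator measurableSet_Iic
    · exact Filter.Eventually.of_forall fun y => Filter.Eventually.of_forall fun t =>
        norm_indicator_le_norm_self _ _
    · have hx : ∀ᵐ t : unitInterval, t ≠ x := by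
        simp [ae_iff]
      filter_upwards [hx] with t ht
      rcases lt_or_gt_of_ne ht with h1 | h1
      · refine ContinuousAt.congr (f := fun _ => f t) continuousAt_const ?_
        filter_upwards [lt_mem_nhds h1] with y hy
        simp [indicator, le_of_lt hy]
      · refine ContinuousAt.congr (f := fun _ => 0) continuousAt_const ?_
        filter_upwards [gt_mem_nhds h1] with y hy
        simp [indicator, not_le.mpr hy]

theorem primitive_apply (f : C(unitInterval, ℂ)) (x : unitInterval) :
    primitive f x = ∫ t in Iic x, f t := rfl

theorem primitive_zero (f : C(unitInterval, ℂ)) : primitive f 0 = 0 := by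
  have h : (Iic (0 : unitInterval)) = {0} := by
    ext t
    simp
  rw [primitive_apply, h, Measure.restrict_eq_zero.mpr (measure_singleton _)]
  simp

theorem norm_primitive_le (f : C(unitInterval, ℂ)) : ‖primitive f‖ ≤ ‖f‖ := by
  refine (ContinuousMap.norm_le _ (norm_nonneg f)).mpr fun x => ?_
  rw [primitive_apply]
  refine (norm_setIntegral_le_of_norm_le_const (C := ‖f‖) (measure_lt_top _ _)
    fun t _ => f.norm_coe_le_norm t).trans ?_
  exact mul_le_of_le_one_right (norm_nonneg f) measureReal_le_one

/-- The linear bijection underlying `Q`. -/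
def QLin : D1 ≃ₗ[ℂ] D where
  toFun := fun (y : D1) => ⟨(primitive y.1.1, y.1),
    ⟨y.2.1, fun x => by rw [primitive_zero, zero_add, primitive_apply]⟩, primitive_zero _, y.2.2⟩
  map_add' := fun y z => by
    refine Subtype.ext (Prod.ext (ContinuousMap.ext fun x => ?_) rfl)
    exact integral_add (integrable_C y.1.1).integrableOn (integrable_C z.1.1).integrableOn
  map_smul' := fun c y => by
    refine Subtype.ext (Prod.ext (ContinuousMap.ext fun x => ?_) rfl)
    exact integral_const_mul c _
  invFun := fun (u : D) => ⟨u.1.2, u.2.1.1, u.2.2.2⟩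
  left_inv := fun y => rfl
  right_inv := fun u => by
    refine Subtype.ext (Prod.ext (ContinuousMap.ext fun x => ?_) rfl)
    have h := u.2.1.2 x
    have h0 : u.1.1 0 = 0 := u.2.2.1
    rw [h0, zero_add] at h
    exact h.symm

/-- The bijective integration operator `Q : D_1 → D`, `[Qy]' = y`, that is `(Qy)(x) = ∫_0^x y`. -/
def Q : D1 ≃L[ℂ] D :=
  QLin.toContinuousLinearEquivOfBounds 1 1
    (fun y => by
      rw [one_mul]
      exact max_le ((norm_primitive_le y.1.1).trans (le_max_left _ _)) le_rfl)
    (fun u => by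
      rw [one_mul]
      exact le_max_right _ _)

/-- The space `D^*` of continuous antilinear functionals on `D`. -/
abbrev DDual : Type := D →L⋆[ℂ] ℂ

theorem first_eq_inner (p : Lp ℝ ∞ (volume : Measure unitInterval)) (f g : L2) :
    ∫ t, (p t : ℂ) * f t * conj (g t) = inner ℂ g (p • f : L2) := by
  rw [L2.inner_def]
  refine integral_congr_ae ?_
  filter_upwards [Lp.coeFn_lpSMul (r := 2) p f] with t ht
  simp [ht, RCLike.inner_apply]

theorem norm_first_le (p : Lp ℝ ∞ (volume : Measure unitInterval)) (f g : L2) :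
    ‖∫ t, (p t : ℂ) * f t * conj (g t)‖ ≤ ‖p‖ * ‖f‖ * ‖g‖ := by
  rw [first_eq_inner, mul_comm]
  refine (norm_inner_le_norm _ _).trans ?_
  exact mul_le_mul_of_nonneg_left (Lp.norm_smul_le p f) (norm_nonneg _)

theorem integrable_second (r : Lp ℝ 1 (volume : Measure unitInterval))
    (f g : C(unitInterval, ℂ)) :
    Integrable (fun t => (r t : ℂ) * f t * conj (g t)) (volume : Measure unitInterval) := by
  have hr : Integrable (fun t => (r t : ℂ)) (volume : Measure unitInterval) :=
    (L1.integrable_coeFn r).ofReal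
  have h : Continuous fun t => f t * conj (g t) := by fun_prop
  have h2 := hr.mul_bdd (c := ‖f‖ * ‖g‖) h.aestronglyMeasurable
    (Filter.Eventually.of_forall fun t => by
      rw [norm_mul, RCLike.norm_conj]
      exact mul_le_mul (f.norm_coe_le_norm t) (g.norm_coe_le_norm t) (norm_nonneg _)
        (norm_nonneg _))
  refine h2.congr (Filter.Eventually.of_forall fun t => ?_)
  simp [mul_assoc]

theorem norm_second_le (r : Lp ℝ 1 (volume : Measure unitInterval))
    (f g : C(unitInterval, ℂ)) :
    ‖∫ t, (r t : ℂ) * f t * conj (g t)‖ ≤ ‖r‖ * ‖f‖ * ‖g‖ := by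
  rw [L1.norm_eq_integral_norm, ← integral_mul_const, ← integral_mul_const]
  refine norm_integral_le_of_norm_le
    (((L1.integrable_coeFn r).norm.mul_const _).mul_const _)
    (Filter.Eventually.of_forall fun t => ?_)
  rw [norm_mul, norm_mul, RCLike.norm_conj, Complex.norm_real]
  exact mul_le_mul (mul_le_mul_of_nonneg_left (f.norm_coe_le_norm t) (norm_nonneg _))
    (g.norm_coe_le_norm t) (norm_nonneg _) (by positivity)

/-- The value
`∫ p u'' conj(v'') + κ u'(1) conj(v'(1))
  - lam * (∫ r u conj(v) + α u'(1) conj(v'(1)) + β u(1) conj(v(1)))`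
of the form of the linear pencil on `u, v ∈ D`. -/
def form (p : Lp ℝ ∞ (volume : Measure unitInterval)) (r : Lp ℝ 1 (volume : Measure unitInterval))
    (κ α β : ℝ) (lam : ℂ) (u v : D) : ℂ :=
  (∫ x, (p x : ℂ) * Dd2 u x * conj (Dd2 v x)) + κ * Dd1 u 1 * conj (Dd1 v 1)
    - lam * ((∫ x, (r x : ℂ) * Dfn u x * conj (Dfn v x)) + α * Dd1 u 1 * conj (Dd1 v 1)
        + β * Dfn u 1 * conj (Dfn v 1))

theorem norm_Dfn_le (u : D) : ‖Dfn u‖ ≤ ‖u‖ := le_max_left _ _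

theorem norm_Dd1_le (u : D) : ‖Dd1 u‖ ≤ ‖u‖ := (le_max_left _ _).trans (le_max_right _ _)

theorem norm_Dd2_le (u : D) : ‖Dd2 u‖ ≤ ‖u‖ := (le_max_right _ _).trans (le_max_right _ _)

theorem form_add_left (p : Lp ℝ ∞ (volume : Measure unitInterval))
    (r : Lp ℝ 1 (volume : Measure unitInterval)) (κ α β : ℝ) (lam : ℂ) (u u' v : D) :
    form p r κ α β lam (u + u') v = form p r κ α β lam u v + form p r κ α β lam u' v := by
  have h2 : Dd2 (u + u') = Dd2 u + Dd2 u' := rfl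
  have h1 : Dd1 (u + u') = Dd1 u + Dd1 u' := rfl
  have h0 : Dfn (u + u') = Dfn u + Dfn u' := rfl
  have hi := integral_add (integrable_second r (Dfn u) (Dfn v))
    (integrable_second r (Dfn u') (Dfn v))
  have hs : ∫ x, (r x : ℂ) * (Dfn u + Dfn u') x * conj (Dfn v x) =
      (∫ x, (r x : ℂ) * Dfn u x * conj (Dfn v x)) +
        ∫ x, (r x : ℂ) * Dfn u' x * conj (Dfn v x) := by
    rw [← hi]
    refine integral_congr_ae (Filter.Eventually.of_forall fun x => ?_)
    simp only [ContinuousMap.add_apply]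
    ring
  rw [form, form, form, h2, h1, h0, hs]
  have hf : (p • (Dd2 u + Dd2 u') : L2) = (p • Dd2 u : L2) + (p • Dd2 u' : L2) :=
    Lp.add_smul p (Dd2 u) (Dd2 u')
  simp only [first_eq_inner, hf, inner_add_right, ContinuousMap.add_apply]
  ring

theorem form_add_right (p : Lp ℝ ∞ (volume : Measure unitInterval))
    (r : Lp ℝ 1 (volume : Measure unitInterval)) (κ α β : ℝ) (lam : ℂ) (u v v' : D) :
    form p r κ α β lam u (v + v') = form p r κ α β lam u v + form p r κ α β lam u v' := by
  have h2 : Dd2 (v + v') = Dd2 v + Dd2 v' := rfl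
  have h1 : Dd1 (v + v') = Dd1 v + Dd1 v' := rfl
  have h0 : Dfn (v + v') = Dfn v + Dfn v' := rfl
  have hi := integral_add (integrable_second r (Dfn u) (Dfn v))
    (integrable_second r (Dfn u) (Dfn v'))
  have hs : ∫ x, (r x : ℂ) * Dfn u x * conj ((Dfn v + Dfn v') x) =
      (∫ x, (r x : ℂ) * Dfn u x * conj (Dfn v x)) +
        ∫ x, (r x : ℂ) * Dfn u x * conj (Dfn v' x) := by
    rw [← hi]
    refine integral_congr_ae (Filter.Eventually.of_forall fun x => ?_)
    simp only [ContinuousMap.add_apply, map_add]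
    ring
  rw [form, form, form, h2, h1, h0, hs]
  simp only [first_eq_inner, inner_add_left, ContinuousMap.add_apply, map_add]
  ring

theorem form_smul_left (p : Lp ℝ ∞ (volume : Measure unitInterval))
    (r : Lp ℝ 1 (volume : Measure unitInterval)) (κ α β : ℝ) (lam c : ℂ) (u v : D) :
    form p r κ α β lam (c • u) v = c * form p r κ α β lam u v := by
  have h2 : Dd2 (c • u) = c • Dd2 u := rfl
  have h1 : Dd1 (c • u) = c • Dd1 u := rfl
  have h0 : Dfn (c • u) = c • Dfn u := rfl
  have hs : ∫ x, (r x : ℂ) * (c • Dfn u) x * conj (Dfn v x) =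
      c * ∫ x, (r x : ℂ) * Dfn u x * conj (Dfn v x) := by
    rw [← integral_const_mul]
    refine integral_congr_ae (Filter.Eventually.of_forall fun x => ?_)
    simp only [ContinuousMap.smul_apply, smul_eq_mul]
    ring
  have hf : (p • (c • Dd2 u) : L2) = c • (p • Dd2 u : L2) := by
    refine Lp.ext ?_
    filter_upwards [Lp.coeFn_lpSMul (r := 2) p (c • Dd2 u), Lp.coeFn_lpSMul (r := 2) p (Dd2 u),
      Lp.coeFn_smul c (Dd2 u), Lp.coeFn_smul c (p • Dd2 u : L2)] with t h3 h4 h5 h6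
    rw [h3, h6, Pi.smul_apply', h5, Pi.smul_apply, Pi.smul_apply, h4, Pi.smul_apply', smul_comm]
  rw [form, form, h2, h1, h0, hs]
  simp only [first_eq_inner, hf, inner_smul_right, ContinuousMap.smul_apply, smul_eq_mul]
  ring

theorem form_smul_right (p : Lp ℝ ∞ (volume : Measure unitInterval))
    (r : Lp ℝ 1 (volume : Measure unitInterval)) (κ α β : ℝ) (lam c : ℂ) (u v : D) :
    form p r κ α β lam u (c • v) = conj c * form p r κ α β lam u v := by
  have h2 : Dd2 (c • v) = c • Dd2 v := rfl
  have h1 : Dd1 (c • v) = c • Dd1 v := rfl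
  have h0 : Dfn (c • v) = c • Dfn v := rfl
  have hs : ∫ x, (r x : ℂ) * Dfn u x * conj ((c • Dfn v) x) =
      conj c * ∫ x, (r x : ℂ) * Dfn u x * conj (Dfn v x) := by
    rw [← integral_const_mul]
    refine integral_congr_ae (Filter.Eventually.of_forall fun x => ?_)
    simp only [ContinuousMap.smul_apply, smul_eq_mul, map_mul]
    ring
  rw [form, form, h2, h1, h0, hs]
  simp only [first_eq_inner, inner_smul_left, ContinuousMap.smul_apply, smul_eq_mul, map_mul]
  ring

theorem norm_point_le (a : ℝ) (f g : C(unitInterval, ℂ)) (x : unitInterval) :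
    ‖(a : ℂ) * f x * conj (g x)‖ ≤ |a| * ‖f‖ * ‖g‖ := by
  rw [norm_mul, norm_mul, RCLike.norm_conj, Complex.norm_real, Real.norm_eq_abs]
  exact mul_le_mul (mul_le_mul_of_nonneg_left (f.norm_coe_le_norm x) (abs_nonneg _))
    (g.norm_coe_le_norm x) (norm_nonneg _) (by positivity)

theorem norm_form_le (p : Lp ℝ ∞ (volume : Measure unitInterval))
    (r : Lp ℝ 1 (volume : Measure unitInterval)) (κ α β : ℝ) (lam : ℂ) (u v : D) :
    ‖form p r κ α β lam u v‖ ≤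
      (‖p‖ + |κ| + ‖lam‖ * (‖r‖ + |α| + |β|)) * ‖u‖ * ‖v‖ := by
  have key : ∀ {a b c M : ℝ}, 0 ≤ M → 0 ≤ a → 0 ≤ b → 0 ≤ c → a ≤ ‖u‖ → b ≤ ‖v‖ →
      c ≤ M * a * b → c ≤ M * (‖u‖ * ‖v‖) := by
    intro a b c M hM ha hb _ hau hbv hc
    rw [mul_assoc] at hc
    exact hc.trans (mul_le_mul_of_nonneg_left (mul_le_mul hau hbv hb (ha.trans hau)) hM)
  have e1 := key (norm_nonneg p) (norm_nonneg _) (norm_nonneg _) (norm_nonneg _)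
    (norm_Dd2_le u) (norm_Dd2_le v) (norm_first_le p (Dd2 u) (Dd2 v))
  have e2 := key (abs_nonneg κ) (norm_nonneg _) (norm_nonneg _) (norm_nonneg _)
    (norm_Dd1_le u) (norm_Dd1_le v) (norm_point_le κ (Dd1 u) (Dd1 v) 1)
  have e3 := key (norm_nonneg r) (norm_nonneg _) (norm_nonneg _) (norm_nonneg _)
    (norm_Dfn_le u) (norm_Dfn_le v) (norm_second_le r (Dfn u) (Dfn v))
  have e4 := key (abs_nonneg α) (norm_nonneg _) (norm_nonneg _) (norm_nonneg _)
    (norm_Dd1_le u) (norm_Dd1_le v) (norm_point_le α (Dd1 u) (Dd1 v) 1)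
  have e5 := key (abs_nonneg β) (norm_nonneg _) (norm_nonneg _) (norm_nonneg _)
    (norm_Dfn_le u) (norm_Dfn_le v) (norm_point_le β (Dfn u) (Dfn v) 1)
  have e6 := mul_le_mul_of_nonneg_left
    (norm_add₃_le.trans (add_le_add (add_le_add e3 e4) e5)) (norm_nonneg lam)
  rw [← norm_mul] at e6
  refine (norm_sub_le _ _).trans ((add_le_add ((norm_add_le _ _).trans (add_le_add e1 e2))
    e6).trans (le_of_eq ?_))
  ring

/-- The linear operator pencil `T : ℂ → B(D, D^*)`,
`⟨T(lam)u, v⟩ = ∫ p u'' conj(v'') + κ u'(1) conj(v'(1))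
  - lam * (∫ r u conj(v) + α u'(1) conj(v'(1)) + β u(1) conj(v(1)))`. -/
def T (p : Lp ℝ ∞ (volume : Measure unitInterval)) (r : Lp ℝ 1 (volume : Measure unitInterval))
    (κ α β : ℝ) (lam : ℂ) : D →L[ℂ] DDual :=
  LinearMap.mkContinuous₂
    (LinearMap.mk₂'ₛₗ (RingHom.id ℂ) (starRingEnd ℂ) (form p r κ α β lam)
      (form_add_left p r κ α β lam) (form_smul_left p r κ α β lam)
      (form_add_right p r κ α β lam) (form_smul_right p r κ α β lam))
    (‖p‖ + |κ| + ‖lam‖ * (‖r‖ + |α| + |β|)) (norm_form_le p r κ α β lam)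

/-- The operator `K = -Q⁻¹ [T(0)]⁻¹ T'(0) Q` on `D_1`, where `T'` is the derivative of the function
`T : ℂ → B(D, D^*)`. -/
def K (p : Lp ℝ ∞ (volume : Measure unitInterval)) (r : Lp ℝ 1 (volume : Measure unitInterval))
    (κ α β : ℝ) : D1 →L[ℂ] D1 :=
  -((Q.symm : D →L[ℂ] D1) ∘L (T p r κ α β 0).inverse ∘L deriv (T p r κ α β) 0 ∘L
    (Q : D1 →L[ℂ] D))

/-- The number of sign changes of a real function on `[0,1]`: the supremum (possibly `∞`) of the
`n` for which there are points `x_0 < x_1 < ... < x_n` such that `f(x_{i-1}) f(x_i) < 0` for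
`i = 1, ..., n`. -/
def signChanges (f : unitInterval → ℝ) : ℕ∞ :=
  ⨆ n ∈ {n : ℕ | ∃ x : Fin (n + 1) → unitInterval, StrictMono x ∧
    ∀ i : Fin n, f (x i.castSucc) * f (x i.succ) < 0}, (n : ℕ∞)

end

end BeamPencil

namespace BeamPencil

noncomputable section

/-! An element of `D` is determined by its second derivative, an arbitrary `f` in `L2`. In this
coordinate `T(0)` is the operator `f ↦ p f + κ ⟨1, f⟩ 1`, a rank-one perturbation of multiplication
by `p`. It is invertible because `1/p` is bounded and `1 + κ ∫ 1/p` is nonzero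
(`T_zero_isInvertible`).

The pencil is affine in the parameter, and its slope sees `u` only through `u` as a continuous
function and the number `u'(1)`. So `K` is a bounded operator after `y ↦ (∫_0^x y, y(1))`, which is
compact by Arzelà–Ascoli (`isCompactOperator_K`).

For the sign changes, two integrations by parts turn the weak equation for `y = Ku` into a chain of
single integrations: `U = ∫_0^x u`, `S = ∫_x^1 r U + β U(1)`, `N = ∫_x^1 S + α u(1) - κ y(1)`, `y =
∫_0^x N/p`. As in Rolle's theorem, a sign alternation of a primitive forces one of its integrand.
Integration from 0 loses nothing, since the primitive vanishes at 0. Integration from 1 with a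
boundary constant `b` can lose only the last point, and only if `b` has the last sign. For `S` the
loss is made up by the point 1, where `U` has the sign of `b`. For `N`, if `y(1)` does not oppose
the last sign, then `α u(1) = b + κ y(1)` has that sign and the point 1 can be restored for `u`. If
`y(1)` opposes the last sign, the alternation of `y` is first lengthened by the point 1. This is
`signChanges_le_of_integral`. -/

/-! ### Primitives, and second derivatives as coordinates on `D`. -/

theorem continuous_setIntegral_Iic {E : Type*} [NormedAddCommGroup E] [NormedSpace ℝ E]
    {f : unitInterval → E} (hf : Integrable f) :
    Continuous fun x : unitInterval => ∫ t in Iic x, f t := by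
  have h : ∀ x : unitInterval, ∫ t in Iic x, f t = ∫ t, (Iic x).indicator f t := fun x =>
    (integral_indicator measurableSet_Iic).symm
  simp_rw [h]
  rw [continuous_iff_continuousAt]
  intro x
  refine continuousAt_of_dominated (bound := fun t => ‖f t‖) ?_ ?_ hf.norm ?_
  · exact Filter.Eventually.of_forall fun y => hf.aestronglyMeasurable.indicator measurableSet_Iic
  · exact Filter.Eventually.of_forall fun y => Filter.Eventually.of_forall fun t =>
      norm_indicator_le_norm_self _ _
  · have hx : ∀ᵐ t : unitInterval, t ≠ x := by
      simp [ae_iff]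
    filter_upwards [hx] with t ht
    rcases lt_or_gt_of_ne ht with h1 | h1
    · refine ContinuousAt.congr (f := fun _ => f t) continuousAt_const ?_
      filter_upwards [lt_mem_nhds h1] with y hy
      simp [indicator, le_of_lt hy]
    · refine ContinuousAt.congr (f := fun _ => 0) continuousAt_const ?_
      filter_upwards [gt_mem_nhds h1] with y hy
      simp [indicator, not_le.mpr hy]

theorem continuous_setIntegral_Ici {E : Type*} [NormedAddCommGroup E] [NormedSpace ℝ E]
    {f : unitInterval → E} (hf : Integrable f) :
    Continuous fun x : unitInterval => ∫ t in Ici x, f t := by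
  have h : (fun x : unitInterval => ∫ t in Ici x, f t) =
      fun x => (∫ t, f t) - ∫ t in Iic x, f t := by
    funext x
    rw [integral_Ici_eq_integral_Ioi, ← compl_Iic, ← integral_add_compl measurableSet_Iic hf,
      add_sub_cancel_left]
  rw [h]
  exact continuous_const.sub (continuous_setIntegral_Iic hf)

theorem setIntegral_Iic_zero (f : unitInterval → ℂ) : ∫ t in Iic (0 : unitInterval), f t = 0 := by
  have h : (Iic (0 : unitInterval)) = {0} := by
    ext t
    simp
  rw [h, Measure.restrict_eq_zero.mpr (measure_singleton _)]
  simp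

theorem Iic_one_eq_univ : Iic (1 : unitInterval) = univ := by
  ext t
  simpa using unitInterval.le_one'

/-- The constant function `1` in `L_2[0,1]`. -/
def one : L2 := indicatorConstLp 2 MeasurableSet.univ (measure_ne_top _ _) 1

theorem coeFn_one : ∀ᵐ t : unitInterval, one t = 1 := by
  filter_upwards [indicatorConstLp_coeFn (p := 2) (hs := MeasurableSet.univ)
    (hμs := measure_ne_top (volume : Measure unitInterval) _) (c := (1 : ℂ))] with t ht
  simpa only [one, indicator_univ] using ht

theorem inner_one (f : L2) : inner ℂ one f = ∫ t, f t := by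
  rw [one, L2.inner_indicatorConstLp_one, setIntegral_univ]

theorem norm_setIntegral_L2_le (f : L2) {s : Set unitInterval} (hs : MeasurableSet s) :
    ‖∫ t in s, f t‖ ≤ ‖f‖ := by
  rw [← L2.inner_indicatorConstLp_one (𝕜 := ℂ) hs (measure_ne_top _ _) f]
  refine (norm_inner_le_norm _ _).trans (mul_le_of_le_one_left (norm_nonneg f) ?_)
  rw [norm_indicatorConstLp (by norm_num) (by norm_num), norm_one, one_mul]
  exact Real.rpow_le_one measureReal_nonneg measureReal_le_one (by simp)

/-- The primitive `x ↦ ∫_0^x f` of a function `f ∈ L_2[0,1]`. -/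
def primitiveL2 (f : L2) : C(unitInterval, ℂ) :=
  ⟨fun x => ∫ t in Iic x, f t, continuous_setIntegral_Iic (integrable_L2 f)⟩

theorem primitiveL2_apply (f : L2) (x : unitInterval) : primitiveL2 f x = ∫ t in Iic x, f t := rfl

theorem norm_primitiveL2_le (f : L2) : ‖primitiveL2 f‖ ≤ ‖f‖ :=
  (ContinuousMap.norm_le _ (norm_nonneg f)).mpr fun _ => norm_setIntegral_L2_le f measurableSet_Iic

/-- The linear bijection `y' ↦ y` of `L_2[0,1]` onto `D_1`. -/
def primitiveLin : L2 ≃ₗ[ℂ] D1 where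
  toFun := fun (f : L2) => ⟨(primitiveL2 f, f),
    fun x => by rw [primitiveL2_apply _ 0, setIntegral_Iic_zero, zero_add, primitiveL2_apply],
    setIntegral_Iic_zero _⟩
  map_add' := fun f g =>
    Subtype.ext (Prod.ext (ContinuousMap.ext fun x => setIntegral_L2_add f g (Iic x)) rfl)
  map_smul' := fun c f =>
    Subtype.ext (Prod.ext (ContinuousMap.ext fun x => setIntegral_L2_smul c f (Iic x)) rfl)
  invFun := fun (y : D1) => y.1.2
  left_inv := fun f => rfl
  right_inv := fun y => by
    refine Subtype.ext (Prod.ext (ContinuousMap.ext fun x => ?_) rfl)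
    have h := y.2.1 x
    have h0 : y.1.1 0 = 0 := y.2.2
    rw [h0, zero_add] at h
    exact h.symm

/-- The isomorphism `f ↦ ∫_0^x f` of `L_2[0,1]` onto `D_1`. -/
def primitiveEquiv : L2 ≃L[ℂ] D1 :=
  primitiveLin.toContinuousLinearEquivOfBounds 1 1
    (fun f => by
      rw [one_mul]
      exact max_le (norm_primitiveL2_le f) le_rfl)
    (fun u => by
      rw [one_mul]
      exact le_max_right _ _)

/-- The isomorphism of `L_2[0,1]` onto `D` inverse to `u ↦ u''`. -/
def primitive2 : L2 ≃L[ℂ] D := primitiveEquiv.trans Q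

theorem Dd2_primitive2 (f : L2) : Dd2 (primitive2 f) = f := rfl

theorem Dd1_primitive2 (f : L2) : Dd1 (primitive2 f) = primitiveL2 f := rfl

theorem Dfn_primitive2 (f : L2) : Dfn (primitive2 f) = primitive (primitiveL2 f) := rfl

theorem primitiveL2_one (f : L2) : primitiveL2 f 1 = inner ℂ one f := by
  rw [primitiveL2_apply, Iic_one_eq_univ, setIntegral_univ, inner_one]

/-- Completeness is what lets the open mapping theorem turn bijectivity of `T(0)` into bounded
invertibility. -/
instance : CompleteSpace D :=
  (completeSpace_congr (e := primitive2.toEquiv) primitive2.isUniformEmbedding).1 inferInstance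

/-! ### Invertibility of `T(0)`. -/

section

variable (p : Lp ℝ ∞ (volume : Measure unitInterval)) (r : Lp ℝ 1 (volume : Measure unitInterval))
  (κ α β : ℝ)

theorem T_apply (lam : ℂ) (u v : D) : T p r κ α β lam u v = form p r κ α β lam u v := rfl

/-- The boundary value `u'(1)` is `∫ f = ⟨1, f⟩`, so the boundary term of the form has rank one on
`L2`. -/
theorem T_zero_primitive2 (f g : L2) :
    T p r κ α β 0 (primitive2 f) (primitive2 g) =
      inner ℂ g ((p • f : L2) + ((κ : ℂ) * inner ℂ one f) • one) := by
  rw [T_apply, form, zero_mul, sub_zero, first_eq_inner, Dd1_primitive2, Dd1_primitive2,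
    Dd2_primitive2, Dd2_primitive2, primitiveL2_one, primitiveL2_one, inner_add_right,
    inner_smul_right, inner_conj_symm]

/-- The function `1/p` as an element of `L_∞[0,1]`. -/
def invLp {p : Lp ℝ ∞ (volume : Measure unitInterval)}
    (h : MemLp (fun x : unitInterval => 1 / p x) ∞ volume) :
    Lp ℝ ∞ (volume : Measure unitInterval) := h.toLp _

variable {p}

theorem lp_smul_const_smul (q : Lp ℝ ∞ (volume : Measure unitInterval)) (c : ℂ) (f : L2) :
    (q • (c • f) : L2) = c • (q • f : L2) := by
  refine Lp.ext ?_
  filter_upwards [Lp.coeFn_lpSMul (r := 2) q (c • f), Lp.coeFn_lpSMul (r := 2) q f,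
    Lp.coeFn_smul c f, Lp.coeFn_smul c (q • f : L2)] with t h3 h4 h5 h6
  rw [h3, h6, Pi.smul_apply', h5, Pi.smul_apply, Pi.smul_apply, h4, Pi.smul_apply', smul_comm]

theorem smul_invLp_smul (hp : ∀ᵐ x : unitInterval, 0 < p x)
    (hp_inv : MemLp (fun x : unitInterval => 1 / p x) ∞ volume)
    (f : L2) : (p • (invLp hp_inv • f : L2) : L2) = f := by
  refine Lp.ext ?_
  filter_upwards [Lp.coeFn_lpSMul (r := 2) p (invLp hp_inv • f : L2),
    Lp.coeFn_lpSMul (r := 2) (invLp hp_inv) f, hp_inv.coeFn_toLp, hp] with t h1 h2 h3 h4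
  rw [h1, Pi.smul_apply', h2, Pi.smul_apply', invLp, h3, smul_smul, mul_one_div_cancel h4.ne',
    one_smul]

theorem invLp_smul_smul (hp : ∀ᵐ x : unitInterval, 0 < p x)
    (hp_inv : MemLp (fun x : unitInterval => 1 / p x) ∞ volume)
    (f : L2) : (invLp hp_inv • (p • f : L2) : L2) = f := by
  refine Lp.ext ?_
  filter_upwards [Lp.coeFn_lpSMul (r := 2) (invLp hp_inv) (p • f : L2),
    Lp.coeFn_lpSMul (r := 2) p f, hp_inv.coeFn_toLp, hp] with t h1 h2 h3 h4
  rw [h1, Pi.smul_apply', h2, Pi.smul_apply', invLp, h3, smul_smul, one_div_mul_cancel h4.ne',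
    one_smul]

theorem inner_one_invLp_smul_one (hp : ∀ᵐ x : unitInterval, 0 < p x)
    (hp_inv : MemLp (fun x : unitInterval => 1 / p x) ∞ volume) :
    ∃ c : ℝ, 0 ≤ c ∧ inner ℂ one (invLp hp_inv • one : L2) = (c : ℂ) := by
  refine ⟨∫ t, 1 / p t, integral_nonneg_of_ae ?_, ?_⟩
  · filter_upwards [hp] with t ht
    exact (one_div_pos.2 ht).le
  · rw [inner_one]
    refine Eq.trans (integral_congr_ae ?_) integral_ofReal
    filter_upwards [Lp.coeFn_lpSMul (r := 2) (invLp hp_inv) one, hp_inv.coeFn_toLp,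
      coeFn_one] with t h1 h2 h3
    rw [h1, Pi.smul_apply', invLp, h2, h3]
    simp

theorem one_add_mul_inner_ne_zero (hp : ∀ᵐ x : unitInterval, 0 < p x)
    (hp_inv : MemLp (fun x : unitInterval => 1 / p x) ∞ volume)
    (hκ : 0 < κ) :
    1 + (κ : ℂ) * inner ℂ one (invLp hp_inv • one : L2) ≠ 0 := by
  obtain ⟨c, hc, h⟩ := inner_one_invLp_smul_one hp hp_inv
  rw [h]
  have : (1 : ℝ) + κ * c ≠ 0 := by positivity
  exact_mod_cast this

/-- Dividing by `p` and pairing with `1` gives `(1 + κ ∫ 1/p) ⟨1, f⟩ = 0`. Hence `⟨1, f⟩ = 0`, the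
rank-one term disappears, and `f = 0`. -/
theorem smul_add_rankOne_injective (hp : ∀ᵐ x : unitInterval, 0 < p x)
    (hp_inv : MemLp (fun x : unitInterval => 1 / p x) ∞ volume)
    (hκ : 0 < κ) (f : L2)
    (h : (p • f : L2) + ((κ : ℂ) * inner ℂ one f) • one = 0) : f = 0 := by
  have hne := one_add_mul_inner_ne_zero κ hp hp_inv hκ
  have h1 : (invLp hp_inv • ((p • f : L2) + ((κ : ℂ) * inner ℂ one f) • one) : L2) = 0 := by
    rw [h]
    exact Lp.smul_zero _ 2 (invLp hp_inv)
  rw [Lp.add_smul, invLp_smul_smul hp hp_inv, lp_smul_const_smul] at h1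
  have h2 : inner ℂ one f = 0 := by
    have := congrArg (inner ℂ one) h1
    rw [inner_add_right, inner_smul_right, inner_zero_right] at this
    refine (mul_eq_zero.1 ?_).resolve_left hne
    linear_combination this
  simpa [h2] using h1

theorem smul_add_rankOne_surjective (hp : ∀ᵐ x : unitInterval, 0 < p x)
    (hp_inv : MemLp (fun x : unitInterval => 1 / p x) ∞ volume)
    (hκ : 0 < κ) (h : L2) :
    ∃ f : L2, (p • f : L2) + ((κ : ℂ) * inner ℂ one f) • one = h := by
  have hne := one_add_mul_inner_ne_zero κ hp hp_inv hκ
  set a := inner ℂ one (invLp hp_inv • one : L2)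
  set b := inner ℂ one (invLp hp_inv • h : L2) with hb
  -- The Sherman–Morrison formula for the inverse of a rank-one perturbation.
  refine ⟨(invLp hp_inv • h : L2) + (-(κ * b / (1 + κ * a))) • (invLp hp_inv • one : L2), ?_⟩
  rw [Lp.add_smul, smul_invLp_smul hp hp_inv, lp_smul_const_smul, smul_invLp_smul hp hp_inv,
    inner_add_right, inner_smul_right, add_assoc,
    ← add_smul, ← hb]
  convert add_zero h
  convert zero_smul ℂ one
  field_simp
  ring

theorem T_zero_isInvertible (hp : ∀ᵐ x : unitInterval, 0 < p x)
    (hp_inv : MemLp (fun x : unitInterval => 1 / p x) ∞ volume)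
    (hκ : 0 < κ) : (T p r κ α β 0).IsInvertible := by
  have hinj : (T p r κ α β 0).ker = ⊥ := by
    rw [LinearMap.ker_eq_bot']
    intro w hw
    obtain ⟨f, rfl⟩ := primitive2.surjective w
    have h : (p • f : L2) + ((κ : ℂ) * inner ℂ one f) • one = 0 := by
      refine ext_inner_left ℂ fun g => ?_
      rw [← T_zero_primitive2 p r κ α β, inner_zero_right]
      exact congrArg (fun φ : DDual => φ (primitive2 g)) hw
    rw [smul_add_rankOne_injective κ hp hp_inv hκ f h, map_zero]
  have hsurj : (T p r κ α β 0).range = ⊤ := by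
    rw [LinearMap.range_eq_top]
    intro φ
    -- The functional `φ` is antilinear, so its conjugate is linear and the Riesz theorem represents
    -- it.
    set h : L2 := (InnerProductSpace.toDual ℂ L2).symm
      ((starL ℂ : ℂ ≃L⋆[ℂ] ℂ).toContinuousLinearMap.comp (φ.comp (primitive2 : L2 →L[ℂ] D)))
    have hh : ∀ g : L2, φ (primitive2 g) = inner ℂ g h := fun g => by
      rw [← inner_conj_symm, InnerProductSpace.toDual_symm_apply]
      exact (Complex.conj_conj _).symm
    obtain ⟨f, hf⟩ := smul_add_rankOne_surjective κ hp hp_inv hκ h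
    refine ⟨primitive2 f, ContinuousLinearMap.ext fun v => ?_⟩
    obtain ⟨g, rfl⟩ := primitive2.surjective v
    rw [hh, ← hf]
    exact T_zero_primitive2 p r κ α β f g
  exact ⟨ContinuousLinearEquiv.ofBijective _ hinj hsurj,
    ContinuousLinearEquiv.coe_ofBijective _ _ _⟩

end

/-! ### The derivative of the pencil and a factorization of `K`. -/

section

variable (p : Lp ℝ ∞ (volume : Measure unitInterval)) (r : Lp ℝ 1 (volume : Measure unitInterval))
  (κ α β : ℝ)

/-- The value `∫ r f conj(v) + α c conj(v'(1)) + β f(1) conj(v(1))`. -/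
def loadForm (a : C(unitInterval, ℂ) × ℂ) (v : D) : ℂ :=
  (∫ x, (r x : ℂ) * a.1 x * conj (Dfn v x)) + α * a.2 * conj (Dd1 v 1)
    + β * a.1 1 * conj (Dfn v 1)

theorem loadForm_add_left (a a' : C(unitInterval, ℂ) × ℂ) (v : D) :
    loadForm r α β (a + a') v = loadForm r α β a v + loadForm r α β a' v := by
  have hs : ∫ x, (r x : ℂ) * (a.1 + a'.1) x * conj (Dfn v x) =
      (∫ x, (r x : ℂ) * a.1 x * conj (Dfn v x)) + ∫ x, (r x : ℂ) * a'.1 x * conj (Dfn v x) := by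
    rw [← integral_add (integrable_second r a.1 (Dfn v)) (integrable_second r a'.1 (Dfn v))]
    refine integral_congr_ae (Filter.Eventually.of_forall fun x => ?_)
    simp only [ContinuousMap.add_apply]
    ring
  rw [loadForm, loadForm, loadForm, Prod.fst_add, Prod.snd_add, hs, ContinuousMap.add_apply]
  ring

theorem loadForm_smul_left (c : ℂ) (a : C(unitInterval, ℂ) × ℂ) (v : D) :
    loadForm r α β (c • a) v = c * loadForm r α β a v := by
  have hs : ∫ x, (r x : ℂ) * (c • a.1) x * conj (Dfn v x) =
      c * ∫ x, (r x : ℂ) * a.1 x * conj (Dfn v x) := by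
    rw [← integral_const_mul]
    refine integral_congr_ae (Filter.Eventually.of_forall fun x => ?_)
    simp only [ContinuousMap.smul_apply, smul_eq_mul]
    ring
  rw [loadForm, loadForm, Prod.smul_fst, Prod.smul_snd, hs, ContinuousMap.smul_apply, smul_eq_mul,
    smul_eq_mul]
  ring

theorem loadForm_add_right (a : C(unitInterval, ℂ) × ℂ) (v v' : D) :
    loadForm r α β a (v + v') = loadForm r α β a v + loadForm r α β a v' := by
  have h1 : Dd1 (v + v') = Dd1 v + Dd1 v' := rfl
  have h0 : Dfn (v + v') = Dfn v + Dfn v' := rfl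
  have hs : ∫ x, (r x : ℂ) * a.1 x * conj ((Dfn v + Dfn v') x) =
      (∫ x, (r x : ℂ) * a.1 x * conj (Dfn v x)) + ∫ x, (r x : ℂ) * a.1 x * conj (Dfn v' x) := by
    rw [← integral_add (integrable_second r a.1 (Dfn v)) (integrable_second r a.1 (Dfn v'))]
    refine integral_congr_ae (Filter.Eventually.of_forall fun x => ?_)
    simp only [ContinuousMap.add_apply, map_add]
    ring
  rw [loadForm, loadForm, loadForm, h0, h1, hs]
  simp only [ContinuousMap.add_apply, map_add]
  ring

theorem loadForm_smul_right (c : ℂ) (a : C(unitInterval, ℂ) × ℂ) (v : D) :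
    loadForm r α β a (c • v) = conj c * loadForm r α β a v := by
  have h1 : Dd1 (c • v) = c • Dd1 v := rfl
  have h0 : Dfn (c • v) = c • Dfn v := rfl
  have hs : ∫ x, (r x : ℂ) * a.1 x * conj ((c • Dfn v) x) =
      conj c * ∫ x, (r x : ℂ) * a.1 x * conj (Dfn v x) := by
    rw [← integral_const_mul]
    refine integral_congr_ae (Filter.Eventually.of_forall fun x => ?_)
    simp only [ContinuousMap.smul_apply, smul_eq_mul, map_mul]
    ring
  rw [loadForm, loadForm, h0, h1, hs]
  simp only [ContinuousMap.smul_apply, smul_eq_mul, map_mul]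
  ring

theorem norm_loadForm_le (a : C(unitInterval, ℂ) × ℂ) (v : D) :
    ‖loadForm r α β a v‖ ≤ (‖r‖ + |α| + |β|) * ‖a‖ * ‖v‖ := by
  have ha1 : ‖a.1‖ ≤ ‖a‖ := norm_fst_le a
  have ha2 : ‖a.2‖ ≤ ‖a‖ := norm_snd_le a
  have hpt : ∀ (b : ℝ) (s t : ℂ), ‖s‖ ≤ ‖a‖ → ‖t‖ ≤ ‖v‖ →
      ‖(b : ℂ) * s * conj t‖ ≤ |b| * ‖a‖ * ‖v‖ := by
    intro b s t hs ht
    rw [norm_mul, norm_mul, RCLike.norm_conj, Complex.norm_real, Real.norm_eq_abs]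
    gcongr
  have e1 : ‖∫ x, (r x : ℂ) * a.1 x * conj (Dfn v x)‖ ≤ ‖r‖ * ‖a‖ * ‖v‖ :=
    (norm_second_le r a.1 (Dfn v)).trans (by gcongr; exact norm_Dfn_le v)
  have e2 := hpt α a.2 (Dd1 v 1) ha2 (((Dd1 v).norm_coe_le_norm 1).trans (norm_Dd1_le v))
  have e3 := hpt β (a.1 1) (Dfn v 1) ((a.1.norm_coe_le_norm 1).trans ha1)
    (((Dfn v).norm_coe_le_norm 1).trans (norm_Dfn_le v))
  refine (norm_add₃_le.trans (add_le_add (add_le_add e1 e2) e3)).trans (le_of_eq ?_)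
  ring

/-- The operator `(f, c) ↦ (v ↦ ∫ r f conj(v) + α c conj(v'(1)) + β f(1) conj(v(1)))`. -/
def load : (C(unitInterval, ℂ) × ℂ) →L[ℂ] DDual :=
  LinearMap.mkContinuous₂
    (LinearMap.mk₂'ₛₗ (RingHom.id ℂ) (starRingEnd ℂ) (loadForm r α β)
      (loadForm_add_left r α β) (loadForm_smul_left r α β)
      (loadForm_add_right r α β) (loadForm_smul_right r α β))
    (‖r‖ + |α| + |β|) (norm_loadForm_le r α β)

/-- The operator `u ↦ (u, u'(1))`. -/
def valueTrace : D →L[ℂ] C(unitInterval, ℂ) × ℂ :=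
  LinearMap.mkContinuous
    { toFun := fun u => (Dfn u, Dd1 u 1)
      map_add' := fun _ _ => rfl
      map_smul' := fun _ _ => rfl } 1
    (fun u => by
      rw [one_mul]
      exact max_le (norm_Dfn_le u) (((Dd1 u).norm_coe_le_norm 1).trans (norm_Dd1_le u)))

theorem T_eq (lam : ℂ) : T p r κ α β lam = T p r κ α β 0 - lam • (load r α β ∘L valueTrace) := by
  refine ContinuousLinearMap.ext fun u => ContinuousLinearMap.ext fun v => ?_
  change form p r κ α β lam u v = form p r κ α β 0 u v - lam * loadForm r α β (valueTrace u) v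
  rw [form, form, loadForm, zero_mul, sub_zero]
  rfl

theorem deriv_const_sub_smul {F : Type*} [NormedAddCommGroup F] [NormedSpace ℂ F] (a b : F)
    (z : ℂ) : deriv (fun lam : ℂ => a - lam • b) z = -b := by
  simpa using (((hasDerivAt_id z).smul_const b).const_sub a).deriv

theorem deriv_T : deriv (T p r κ α β) 0 = -(load r α β ∘L valueTrace) := by
  have h : T p r κ α β = fun lam : ℂ => T p r κ α β 0 - lam • (load r α β ∘L valueTrace) :=
    funext (T_eq p r κ α β)
  rw [h]
  exact deriv_const_sub_smul (F := D →L[ℂ] DDual) _ _ 0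

/-- The two minus signs cancel, and the rightmost factor is the one that will be compact. No
invertibility is needed here, since `inverse` is a bounded operator in every case (zero by default).
-/
theorem K_eq : K p r κ α β =
    ((Q.symm : D →L[ℂ] D1) ∘L (T p r κ α β 0).inverse ∘L load r α β) ∘L
      (valueTrace ∘L (Q : D1 →L[ℂ] D)) := by
  rw [K, deriv_T]
  refine ContinuousLinearMap.ext fun u => ?_
  simp

/-- The weak equation satisfied by `Ku`, from which everything about its sign changes is derived. -/
theorem T_zero_Q_K (h : (T p r κ α β 0).IsInvertible) (u : D1) :
    T p r κ α β 0 (Q (K p r κ α β u)) = load r α β (valueTrace (Q u)) := by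
  rw [K_eq]
  simp [h.self_apply_inverse]

end

/-! ### Compactness of `K`. -/

theorem dist_primitive_le (f : C(unitInterval, ℂ)) {M : ℝ} (hf : ‖f‖ ≤ M) (x y : unitInterval) :
    dist (primitive f x) (primitive f y) ≤ M * dist x y := by
  wlog hxy : x ≤ y generalizing x y
  · rw [dist_comm, dist_comm x y]
    exact this y x (le_of_not_ge hxy)
  rw [dist_comm, dist_eq_norm, primitive_apply, primitive_apply, ← Iic_union_Ioc_eq_Iic hxy,
    setIntegral_union (Iic_disjoint_Ioc le_rfl) measurableSet_Ioc
      (integrable_C f).integrableOn (integrable_C f).integrableOn, add_sub_cancel_left]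
  refine (norm_setIntegral_le_of_norm_le_const (measure_lt_top _ _)
    fun t _ => (f.norm_coe_le_norm t).trans hf).trans (le_of_eq ?_)
  congr 1
  have h : 0 ≤ (y : ℝ) - x := sub_nonneg.2 hxy
  rw [Measure.real, unitInterval.volume_Ioc, ENNReal.toReal_ofReal h, dist_comm,
    Subtype.dist_eq, Real.dist_eq, abs_of_nonneg h]

/-- Primitives of functions bounded by `M` are uniformly bounded and have the common Lipschitz
constant `M`, so Arzelà–Ascoli applies. -/
theorem isCompact_closure_image_primitive (M : ℝ) :
    IsCompact (closure (primitive '' Metric.closedBall 0 M)) := by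
  let e := ContinuousMap.isometryEquivBoundedOfCompact unitInterval ℂ
  have h : IsCompact (closure (e '' (primitive '' Metric.closedBall 0 M))) := by
    refine BoundedContinuousFunction.arzela_ascoli (Metric.closedBall 0 M)
      (isCompact_closedBall 0 M) _ ?_ ?_
    · rintro _ x ⟨_, ⟨f, hf, rfl⟩, rfl⟩
      rw [mem_closedBall_zero_iff] at hf ⊢
      exact ((primitive f).norm_coe_le_norm x).trans ((norm_primitive_le f).trans hf)
    · refine Metric.equicontinuous_of_continuity_modulus (fun d => M * d) ?_ _ ?_
      · have : Continuous fun d : ℝ => M * d := by fun_prop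
        simpa using this.tendsto 0
      · rintro x y ⟨_, ⟨_, ⟨f, hf, rfl⟩, rfl⟩⟩
        exact dist_primitive_le f (mem_closedBall_zero_iff.1 hf) x y
  rw [← e.toHomeomorph.isCompact_image]
  exact (e.toHomeomorph.image_closure _).symm ▸ h

/-- On the unit ball of `D1` the first component is a primitive of a function bounded by 1, and the
second is a number in the closed unit disc. -/
theorem isCompactOperator_valueTrace_Q : IsCompactOperator (valueTrace ∘L (Q : D1 →L[ℂ] D)) := by
  rw [isCompactOperator_iff_exists_mem_nhds_image_subset_compact]
  refine ⟨Metric.closedBall 0 1, Metric.closedBall_mem_nhds 0 one_pos,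
    closure (primitive '' Metric.closedBall 0 1) ×ˢ Metric.closedBall (0 : ℂ) 1,
    (isCompact_closure_image_primitive 1).prod (isCompact_closedBall 0 1), ?_⟩
  rintro _ ⟨u, hu, rfl⟩
  rw [mem_closedBall_zero_iff] at hu
  have h1 : ‖D1fn u‖ ≤ 1 := (le_max_left _ _).trans hu
  exact ⟨subset_closure ⟨D1fn u, mem_closedBall_zero_iff.2 h1, rfl⟩,
    mem_closedBall_zero_iff.2 (((D1fn u).norm_coe_le_norm 1).trans h1)⟩

theorem isCompactOperator_K (p : Lp ℝ ∞ (volume : Measure unitInterval))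
    (r : Lp ℝ 1 (volume : Measure unitInterval)) (κ α β : ℝ) :
    IsCompactOperator (K p r κ α β) := by
  rw [K_eq]
  exact isCompactOperator_valueTrace_Q.clm_comp
    ((Q.symm : D →L[ℂ] D1) ∘L (T p r κ α β 0).inverse ∘L load r α β)

/-! ### Alternating sequences and the number of sign changes. -/

/-- The first `m` points of the sequence `x` are increasing, and the values of `f` at them have
alternating signs, starting with the sign of `ε`. -/
def Alternates (f : unitInterval → ℝ) (m : ℕ) (ε : ℝ) (x : ℕ → unitInterval) : Prop :=
  (∀ i, i + 1 < m → x i < x (i + 1)) ∧ ∀ i < m, 0 < ε * (-1) ^ i * f (x i)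

variable {f F w : unitInterval → ℝ} {m : ℕ} {ε : ℝ} {x : ℕ → unitInterval}

theorem Alternates.mono {n : ℕ} (h : Alternates f m ε x) (hn : n ≤ m) : Alternates f n ε x :=
  ⟨fun i hi => h.1 i (by omega), fun i hi => h.2 i (by omega)⟩

theorem Alternates.le_last (h : Alternates f (m + 1) ε x) {i : ℕ} (hi : i ≤ m) : x i ≤ x m := by
  induction m with
  | zero => rw [Nat.le_zero.1 hi]
  | succ k ih =>
    rcases hi.eq_or_lt with rfl | hi
    · rfl
    · exact (ih (h.mono (by omega)) (by omega)).trans (h.1 k (by omega)).le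

theorem Alternates.append (h : Alternates f m ε x) {y : unitInterval}
    (hy : ∀ i < m, x i < y) (hf : 0 < ε * (-1) ^ m * f y) :
    ∃ z, Alternates f (m + 1) ε z := by
  refine ⟨fun i => if i < m then x i else y, fun i hi => ?_, fun i hi => ?_⟩
  · have him : i < m := by omega
    simp only [if_pos him]
    split_ifs with h1
    · exact h.1 i h1
    · exact hy i him
  · rcases (Nat.lt_succ_iff.1 hi).eq_or_lt with rfl | h1
    · simpa using hf
    · simpa [h1] using h.2 i h1

theorem le_signChanges {n : ℕ} (h : Alternates f (n + 1) ε x) : (n : ℕ∞) ≤ signChanges f := by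
  refine le_iSup₂_of_le n ⟨fun i => x i, ?_, fun i => ?_⟩ le_rfl
  · exact Fin.strictMono_iff_lt_succ.2 fun i => h.1 i (by have := i.2; omega)
  · have h1 := h.2 i (by have := i.2; omega)
    have h2 := h.2 (i + 1) (by have := i.2; omega)
    have h3 := mul_pos h1 h2
    have h4 : ε * (-1) ^ (i : ℕ) * f (x i) * (ε * (-1) ^ ((i : ℕ) + 1) * f (x (i + 1))) =
        -((ε * (-1) ^ (i : ℕ)) ^ 2 * (f (x i) * f (x (i + 1)))) := by ring
    rw [h4] at h3
    simp only [Fin.val_castSucc, Fin.val_succ]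
    by_contra hc
    have := mul_nonneg (sq_nonneg (ε * (-1) ^ (i : ℕ))) (not_lt.1 hc)
    linarith

/-- If every alternating sequence of values of `f` is matched by one of `g` then `f` has at most as
many sign changes as `g`. -/
theorem signChanges_le {g : unitInterval → ℝ}
    (hg : ∀ n ε x, Alternates f (n + 1) ε x → ∃ z, Alternates g (n + 1) ε z) :
    signChanges f ≤ signChanges g := by
  refine iSup₂_le fun n hn => ?_
  obtain ⟨x, hx, hfx⟩ := hn
  -- For `n = 0` the value `f (x 0)` may vanish and could not serve as the sign `ε`.
  rcases Nat.eq_zero_or_pos n with rfl | hpos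
  · exact zero_le
  have hmin : ∀ i, min i n < n + 1 := fun i => by omega
  -- The finite sequence is continued by its last point, and `ε` is the first value itself rather
  -- than its sign.
  obtain ⟨z, hz⟩ := hg n (f (x 0)) (fun i => x ⟨min i n, hmin i⟩)
    ⟨fun i hi => hx (by simp [Fin.lt_def]; omega), fun i hi => by
      induction i with
      | zero =>
        have h0 := hfx ⟨0, hpos⟩
        have h1 : f (x 0) ≠ 0 := by
          intro h
          simp [h] at h0
        simpa using mul_self_pos.2 h1
      | succ k ih =>
        have h1 := ih (by omega)
        have h2 := hfx ⟨k, by omega⟩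
        have e1 : (⟨min k n, hmin k⟩ : Fin (n + 1)) = (⟨k, by omega⟩ : Fin n).castSucc :=
          Fin.ext (by simp; omega)
        have e2 : (⟨min (k + 1) n, hmin (k + 1)⟩ : Fin (n + 1)) = (⟨k, by omega⟩ : Fin n).succ :=
          Fin.ext (by simp; omega)
        simp only [e1, e2] at h1 ⊢
        set a := f (x (⟨k, by omega⟩ : Fin n).castSucc)
        set b := f (x (⟨k, by omega⟩ : Fin n).succ)
        set c := f (x 0) * (-1) ^ k with hc
        have e3 : f (x 0) * (-1) ^ (k + 1) = -c := by rw [hc]; ring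
        rw [e3]
        by_contra h3
        have h4 : 0 ≤ c * b := by linarith
        have h5 : c * a * (c * b) = c ^ 2 * (a * b) := by ring
        have h6 := mul_nonneg h1.le h4
        have hc0 : c ≠ 0 := by
          intro h
          simp [h] at h1
        have := mul_neg_of_pos_of_neg (sq_pos_of_ne_zero hc0) h2
        linarith⟩
  exact le_signChanges hz

/-! ### Descent of alternations through one integration. -/

/-- If `w > 0` and `σ ∫_s f w > 0` then `σ f` is positive somewhere on `s`. -/
theorem exists_pos_of_setIntegral_pos {s : Set unitInterval} (hs : MeasurableSet s)
    (hw : ∀ᵐ t : unitInterval, 0 < w t) {σ : ℝ} (h : 0 < σ * ∫ t in s, f t * w t) :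
    ∃ t ∈ s, 0 < σ * f t := by
  by_contra! hc
  rw [← integral_const_mul] at h
  refine h.not_ge (integral_nonpos_of_ae ?_)
  filter_upwards [ae_restrict_of_ae hw, ae_restrict_mem hs] with t h1 h2
  rw [← mul_assoc]
  exact mul_nonpos_of_nonpos_of_nonneg (hc t h2) h1.le

theorem setIntegral_Iic_sub {f : unitInterval → ℝ} (hf : Integrable f) {a b : unitInterval}
    (hab : a ≤ b) : (∫ t in Iic b, f t) - ∫ t in Iic a, f t = ∫ t in Ioo a b, f t := by
  rw [← Iic_union_Ioc_eq_Iic hab, setIntegral_union (Iic_disjoint_Ioc le_rfl) measurableSet_Ioc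
    hf.integrableOn hf.integrableOn, integral_Ioc_eq_integral_Ioo]
  ring

theorem setIntegral_Ici_sub {f : unitInterval → ℝ} (hf : Integrable f) {a b : unitInterval}
    (hab : a ≤ b) : (∫ t in Ici a, f t) - ∫ t in Ici b, f t = ∫ t in Ioo a b, f t := by
  rw [← Ico_union_Ici_eq_Ici hab, setIntegral_union
    (Set.disjoint_left.2 fun t h1 h2 => h1.2.not_ge h2) measurableSet_Ici
    hf.integrableOn hf.integrableOn, integral_Ico_eq_integral_Ioo]
  ring

theorem setIntegral_Ici_eq_Ioi (f : unitInterval → ℝ) (a : unitInterval) :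
    ∫ t in Ici a, f t = ∫ t in Ioi a, f t := integral_Ici_eq_integral_Ioi

theorem setIntegral_Iic_eq_Iio (f : unitInterval → ℝ) (a : unitInterval) :
    ∫ t in Iic a, f t = ∫ t in Iio a, f t := integral_Iic_eq_integral_Iio

/-- Sign alternations of `x ↦ ∫_0^x f w` descend to `f`. -/
theorem Alternates.of_integral_Iic (h : Alternates F m ε x) (hw : ∀ᵐ t : unitInterval, 0 < w t)
    (hfw : Integrable fun t => f t * w t) (hF : ∀ y, F y = ∫ t in Iic y, f t * w t) :
    ∃ z, Alternates f m ε z ∧ ∀ i < m, z i < x i := by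
  have key : ∀ i, ∃ t, i < m → t < x i ∧ (∀ j, j + 1 = i → x j < t) ∧
      0 < ε * (-1) ^ i * f t := by
    intro i
    by_cases hi : i < m
    swap
    · exact ⟨0, fun h => (hi h).elim⟩
    have hFi := h.2 i hi
    cases i with
    | zero =>
      -- Since `F` vanishes at 0, its first value is already an integral of `f w`, so the first
      -- interval also yields a point.
      rw [hF, setIntegral_Iic_eq_Iio] at hFi
      obtain ⟨t, ht, h1⟩ := exists_pos_of_setIntegral_pos measurableSet_Iio hw hFi
      exact ⟨t, fun _ => ⟨ht, by omega, h1⟩⟩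
    | succ k =>
      have hlt := h.1 k hi
      have hFk := h.2 k (by omega)
      -- An increment between values of opposite sign has the sign of the later one.
      have : 0 < ε * (-1) ^ (k + 1) * ∫ t in Ioo (x k) (x (k + 1)), f t * w t := by
        rw [← setIntegral_Iic_sub hfw hlt.le, ← hF, ← hF]
        rw [pow_succ] at hFi ⊢
        linarith
      obtain ⟨t, ht, h1⟩ := exists_pos_of_setIntegral_pos measurableSet_Ioo hw this
      refine ⟨t, fun _ => ⟨ht.2, fun j hj => ?_, h1⟩⟩
      obtain rfl : j = k := by omega
      exact ht.1
  choose z hz using key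
  exact ⟨z, ⟨fun i hi => (hz i (by omega)).1.trans ((hz (i + 1) hi).2.1 i rfl),
    fun i hi => (hz i hi).2.2⟩, fun i hi => (hz i hi).1⟩

/-- Sign alternations of `x ↦ ∫_x^1 f w + b` descend to `f`, up to the last one. -/
theorem Alternates.of_integral_Ici (h : Alternates F (m + 1) ε x) {b : ℝ}
    (hw : ∀ᵐ t : unitInterval, 0 < w t) (hfw : Integrable fun t => f t * w t)
    (hF : ∀ y, F y = (∫ t in Ici y, f t * w t) + b) :
    ∃ z, Alternates f m ε z ∧ ∀ i < m, z i < x m := by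
  have key : ∀ i, ∃ t, i < m → x i < t ∧ t < x (i + 1) ∧ 0 < ε * (-1) ^ i * f t := by
    intro i
    by_cases hi : i < m
    swap
    · exact ⟨0, fun h => (hi h).elim⟩
    have hlt := h.1 i (by omega)
    have hFi := h.2 i (by omega)
    have hFk := h.2 (i + 1) (by omega)
    -- For integrals up to 1 the difference carries the sign of the earlier value. The constant `b`
    -- cancels in it.
    have : 0 < ε * (-1) ^ i * ∫ t in Ioo (x i) (x (i + 1)), f t * w t := by
      rw [← setIntegral_Ici_sub hfw hlt.le]
      rw [hF] at hFi hFk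
      rw [pow_succ] at hFk
      linarith
    obtain ⟨t, ht, h1⟩ := exists_pos_of_setIntegral_pos measurableSet_Ioo hw this
    exact ⟨t, fun _ => ⟨ht.1, ht.2, h1⟩⟩
  choose z hz using key
  exact ⟨z, ⟨fun i hi => (hz i (by omega)).2.1.trans (hz (i + 1) hi).1,
    fun i hi => (hz i hi).2.2⟩,
    fun i hi => (hz i hi).2.1.trans_le (h.le_last (by omega))⟩

/-- Sign alternations of `x ↦ ∫_x^1 f w + b` descend to `f` if `b` does not have the last sign. -/
theorem Alternates.of_integral_Ici_of_nonpos (h : Alternates F (m + 1) ε x) {b : ℝ}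
    (hw : ∀ᵐ t : unitInterval, 0 < w t) (hfw : Integrable fun t => f t * w t)
    (hF : ∀ y, F y = (∫ t in Ici y, f t * w t) + b) (hb : ε * (-1) ^ m * b ≤ 0) :
    ∃ z, Alternates f (m + 1) ε z := by
  obtain ⟨z, hz, hzx⟩ := h.of_integral_Ici hw hfw hF
  have hFm := h.2 m (by omega)
  -- As `b` does not contribute to the last sign, the tail integral must have it. This gives the
  -- missing point to the right of `x m`.
  have : 0 < ε * (-1) ^ m * ∫ t in Ioi (x m), f t * w t := by
    rw [hF, setIntegral_Ici_eq_Ioi] at hFm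
    linarith
  obtain ⟨t, ht, h1⟩ := exists_pos_of_setIntegral_pos measurableSet_Ioi hw this
  exact hz.append (fun i hi => (hzx i hi).trans ht) h1

/-! ### The chain of four integrations. -/

section

variable {u U S N y r q : unitInterval → ℝ} {κ α β c : ℝ}

/-- Sign alternations of `S(x) = ∫_x^1 r U + β U(1)`, `U(x) = ∫_0^x u`, descend to `u`. -/
theorem Alternates.of_load (h : Alternates S m ε x) (hr : ∀ᵐ t : unitInterval, 0 < r t)
    (hβ : 0 < β) (hu : Integrable u) (hU : ∀ a, U a = ∫ t in Iic a, u t)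
    (hrU : Integrable fun t => U t * r t) (hS : ∀ a, S a = (∫ t in Ici a, U t * r t) + β * U 1) :
    ∃ z, Alternates u m ε z ∧ ∀ i < m, z i < 1 := by
  have hSU : ∃ z, Alternates U m ε z := by
    cases m with
    | zero => exact ⟨x, fun i hi => by omega, fun i hi => by omega⟩
    | succ m =>
      rcases le_or_gt (ε * (-1) ^ m * (β * U 1)) 0 with h1 | h1
      · exact h.of_integral_Ici_of_nonpos hr hrU hS h1
      · obtain ⟨z, hz, hzx⟩ := h.of_integral_Ici hr hrU hS
        -- The boundary constant `β U(1)` has the last sign, hence so does `U(1)`.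
        refine hz.append (y := 1) (fun i hi => (hzx i hi).trans_le unitInterval.le_one') ?_
        refine pos_of_mul_pos_right (a := β) ?_ hβ.le
        linarith
  obtain ⟨z, hz⟩ := hSU
  obtain ⟨z', hz', hlt⟩ := hz.of_integral_Iic (f := u) (w := fun _ => 1) (by simp)
    (by simpa using hu) (by simpa using hU)
  exact ⟨z', hz', fun i hi => (hlt i hi).trans_le unitInterval.le_one'⟩

/-- Let `U(x) = ∫_0^x u`, `S(x) = ∫_x^1 r U + β U(1)`, `N(x) = ∫_x^1 S + c`, `y(x) = ∫_0^x q N`, and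
`c + κ y(1) = α u(1)`.  Then `y` has at most as many sign changes as `u`. -/
theorem signChanges_le_of_integral (hr : ∀ᵐ t : unitInterval, 0 < r t)
    (hq : ∀ᵐ t : unitInterval, 0 < q t) (hκ : 0 < κ) (hα : 0 ≤ α) (hβ : 0 < β)
    (hu : Integrable u) (hU : ∀ a, U a = ∫ t in Iic a, u t)
    (hrU : Integrable fun t => U t * r t) (hS : ∀ a, S a = (∫ t in Ici a, U t * r t) + β * U 1)
    (hSi : Integrable S) (hN : ∀ a, N a = (∫ t in Ici a, S t) + c)
    (hqN : Integrable fun t => N t * q t) (hy : ∀ a, y a = ∫ t in Iic a, N t * q t)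
    (hc : c + κ * y 1 = α * u 1) : signChanges y ≤ signChanges u := by
  -- First the case in which `y(1)` does not oppose the last sign of the alternation.
  have key : ∀ n ε x, Alternates y (n + 1) ε x → 0 ≤ ε * (-1) ^ n * y 1 →
      ∃ z, Alternates u (n + 1) ε z := by
    intro n ε x h hy1
    obtain ⟨z, hz, -⟩ := h.of_integral_Iic hq hqN hy
    have hSi' : Integrable fun t => S t * (fun _ => (1 : ℝ)) t := by simpa using hSi
    have hN' : ∀ a, N a = (∫ t in Ici a, S t * (fun _ => (1 : ℝ)) t) + c := by simpa using hN
    rcases le_or_gt (ε * (-1) ^ n * c) 0 with h1 | h1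
    · obtain ⟨s, hs⟩ := hz.of_integral_Ici_of_nonpos (by simp) hSi' hN' h1
      obtain ⟨v, hv, -⟩ := hs.of_load hr hβ hu hU hrU hS
      exact ⟨v, hv⟩
    · obtain ⟨s, hs, -⟩ := hz.of_integral_Ici (by simp) hSi' hN'
      obtain ⟨v, hv, hv1⟩ := hs.of_load hr hβ hu hU hrU hS
      -- Here `c` has the last sign and `κ y(1)` does not oppose it, so `α u(1) = c + κ y(1)` has it
      -- too. The point 1 replaces the lost one; the strict bound `hv1` leaves room for it.
      refine hv.append hv1 (pos_of_mul_pos_right (a := α) ?_ hα)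
      have h2 := mul_nonneg hκ.le hy1
      have h3 : α * (ε * (-1) ^ n * u 1) = ε * (-1) ^ n * c + κ * (ε * (-1) ^ n * y 1) := by
        linear_combination (-(ε * (-1) ^ n)) * hc
      linarith
  refine signChanges_le fun n ε x h => ?_
  rcases le_or_gt 0 (ε * (-1) ^ n * y 1) with h1 | h1
  · exact key n ε x h h1
  -- Otherwise `y(1)` would be the last value of the alternation and have the last sign.
  have hlast : x n < 1 := by
    refine lt_of_le_of_ne unitInterval.le_one' fun h2 => ?_
    have := h.2 n (by omega)
    rw [h2] at this
    linarith
  have h2 : 0 < ε * (-1) ^ (n + 1) * y 1 := by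
    rw [pow_succ]
    linarith
  -- With the point 1 appended, `y(1)` has the new last sign and `key` applies; the surplus point of
  -- the result is dropped.
  obtain ⟨x', hx'⟩ := h.append (fun i hi => (h.le_last (by omega)).trans_lt hlast) h2
  obtain ⟨z, hz⟩ := key (n + 1) ε x' hx' h2.le
  exact ⟨z, hz.mono (by omega)⟩

end

/-! ### From the weak equation to the chain of integrals. -/

theorem integrable_of_continuous {f : unitInterval → ℝ} (hf : Continuous f) : Integrable f :=
  hf.integrable_of_hasCompactSupport (HasCompactSupport.of_compactSpace _)

theorem integrable_continuous_mul {f g : unitInterval → ℝ} (hf : Continuous f)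
    (hg : Integrable g) : Integrable fun t => f t * g t := by
  obtain ⟨C, hC⟩ := isCompact_univ.exists_bound_of_continuousOn hf.continuousOn
  exact hg.bdd_mul hf.aestronglyMeasurable (Filter.Eventually.of_forall fun t => hC t (mem_univ t))

theorem integrable_conj {f : unitInterval → ℂ} (hf : Integrable f) :
    Integrable fun t => conj (f t) :=
  Complex.conjCLE.toContinuousLinearMap.integrable_comp hf

/-- Integration by parts: `∫ a(t) (∫_0^t b) dt = ∫ (∫_s^1 a) b(s) ds`. -/
theorem integral_mul_setIntegral_Iic {a : unitInterval → ℝ} {b : unitInterval → ℂ}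
    (ha : Integrable a) (hb : Integrable b) :
    ∫ t, (a t : ℂ) * ∫ s in Iic t, b s = ∫ s, ((∫ t in Ici s, a t : ℝ) : ℂ) * b s := by
  have hm : MeasurableSet {z : unitInterval × unitInterval | z.2 ≤ z.1} :=
    measurableSet_le measurable_snd measurable_fst
  -- Fubini's theorem on the triangle `s ≤ t`.
  have h_int : Integrable (Function.uncurry fun t s : unitInterval =>
      {z : unitInterval × unitInterval | z.2 ≤ z.1}.indicator (fun z => (a z.1 : ℂ) * b z.2) (t, s))
      (volume.prod volume) := (ha.ofReal.mul_prod hb).indicator hm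
  have h := integral_integral_swap h_int
  have h1 : ∀ t, ∫ s, {z : unitInterval × unitInterval | z.2 ≤ z.1}.indicator
      (fun z => (a z.1 : ℂ) * b z.2) (t, s) = (a t : ℂ) * ∫ s in Iic t, b s := by
    intro t
    rw [← integral_const_mul, ← integral_indicator measurableSet_Iic]
    rfl
  have h2 : ∀ s, ∫ t, {z : unitInterval × unitInterval | z.2 ≤ z.1}.indicator
      (fun z => (a z.1 : ℂ) * b z.2) (t, s) = ((∫ t in Ici s, a t : ℝ) : ℂ) * b s := by
    intro s
    rw [← integral_complex_ofReal, ← integral_mul_const, ← integral_indicator measurableSet_Ici]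
    rfl
  simpa only [h1, h2] using h

/-- The form of the load `(U, c)`, with `U` and `c` real, as an inner product in `L_2[0,1]` of
second derivatives. -/
theorem loadForm_primitive2 (r : Lp ℝ 1 (volume : Measure unitInterval)) (α β : ℝ)
    {U S : unitInterval → ℝ} {c : ℝ} {a : C(unitInterval, ℂ) × ℂ} (ha : ∀ x, a.1 x = U x)
    (hac : a.2 = c) (hrU : Integrable fun t => U t * r t)
    (hS : ∀ x, S x = (∫ t in Ici x, U t * r t) + β * U 1) (hSc : Continuous S) (g : L2) :
    loadForm r α β a (primitive2 g) =
      ∫ s, (((∫ t in Ici s, S t) + α * c : ℝ) : ℂ) * conj (g s) := by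
  have hg : Integrable fun s => conj (g s) := integrable_conj (integrable_L2 g)
  have hV : Integrable fun s => conj (primitiveL2 g s) :=
    integrable_conj (integrable_C (primitiveL2 g))
  have hSi := integrable_of_continuous hSc
  have hV1 : ∀ t, conj (primitiveL2 g t) = ∫ s in Iic t, conj (g s) := fun t => by
    rw [primitiveL2_apply, integral_conj]
  have hW1 : ∀ t, conj (primitive (primitiveL2 g) t) = ∫ s in Iic t, conj (primitiveL2 g s) :=
    fun t => by rw [primitive_apply, integral_conj]
  have e1 : ∫ x, (r x : ℂ) * a.1 x * conj (primitive (primitiveL2 g) x) =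
      ∫ s, ((∫ t in Ici s, U t * r t : ℝ) : ℂ) * conj (primitiveL2 g s) := by
    rw [← integral_mul_setIntegral_Iic hrU hV]
    refine integral_congr_ae (Filter.Eventually.of_forall fun x => ?_)
    simp only [hW1, ha]
    push_cast
    ring
  -- The point load at 1 acts on `v(1) = ∫ v'`, so it adds the constant `β U(1)` to the tail
  -- integral and produces `S`.
  have e2 : (∫ s, ((∫ t in Ici s, U t * r t : ℝ) : ℂ) * conj (primitiveL2 g s)) +
      β * a.1 1 * conj (primitive (primitiveL2 g) 1) =
      ∫ s, (S s : ℂ) * conj (primitiveL2 g s) := by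
    rw [hW1, Iic_one_eq_univ, setIntegral_univ, ← integral_const_mul, ← integral_add]
    · refine integral_congr_ae (Filter.Eventually.of_forall fun x => ?_)
      simp only [hS, ha]
      push_cast
      ring
    · have h := continuous_setIntegral_Ici hrU
      have h2 : Continuous fun s =>
          ((∫ t in Ici s, U t * r t : ℝ) : ℂ) * conj (primitiveL2 g s) := by
        fun_prop
      exact integrable_C ⟨_, h2⟩
    · exact hV.const_mul _
  -- Second integration by parts; `v'(1) = ∫ v''` in the same way adds the constant `α c`.
  have e3 : (∫ s, (S s : ℂ) * conj (primitiveL2 g s)) + α * a.2 * conj (primitiveL2 g 1) =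
      ∫ s, (((∫ t in Ici s, S t) + α * c : ℝ) : ℂ) * conj (g s) := by
    simp_rw [hV1]
    rw [integral_mul_setIntegral_Iic hSi hg, Iic_one_eq_univ, setIntegral_univ,
      ← integral_const_mul, ← integral_add]
    · refine integral_congr_ae (Filter.Eventually.of_forall fun x => ?_)
      simp only [hac]
      push_cast
      ring
    · have h : Continuous fun s => ((∫ t in Ici s, S t : ℝ) : ℂ) :=
        Complex.continuous_ofReal.comp (continuous_setIntegral_Ici hSi)
      obtain ⟨C, hC⟩ := isCompact_univ.exists_bound_of_continuousOn h.continuousOn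
      exact hg.bdd_mul h.aestronglyMeasurable
        (Filter.Eventually.of_forall fun t => hC t (mem_univ t))
    · exact hg.const_mul _
  rw [loadForm, Dfn_primitive2, Dd1_primitive2, e1, ← e3, ← e2]
  ring

/-- If `p f + κ ∫ f = N` with a real function `N`, then the primitive of `f` is real, and is given
by `∫_0^x (N - κ ∫ f) / p`. -/
theorem exists_real_of_smul_add_eq {p : Lp ℝ ∞ (volume : Measure unitInterval)} {κ : ℝ}
    (hp : ∀ᵐ x : unitInterval, 0 < p x) (hκ : 0 < κ)
    {N : unitInterval → ℝ} {f : L2}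
    (h : ∀ᵐ t, (p t : ℂ) * f t + κ * ∫ s, f s = N t) :
    ∃ Y : ℝ, ∀ x, primitiveL2 f x = (∫ t in Iic x, (N t - κ * Y) * (1 / p t) : ℝ) ∧
      primitiveL2 f 1 = Y := by
  set I := ∫ s, f s with hI
  -- As `N` and `p` are real, the imaginary part of `f` is `-κ (Im I) / p`; integrating gives an
  -- equation that forces `Im I = 0`.
  have h_int : I.im = -κ * I.im * ∫ t, 1 / p t := by
    have h1 : I.im = ∫ t, (f t).im := (integral_im (integrable_L2 f)).symm
    rw [← integral_const_mul]
    conv_lhs => rw [h1]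
    refine integral_congr_ae ?_
    filter_upwards [h, hp] with t h2 h3
    have h4 := congrArg Complex.im h2
    simp at h4
    field_simp
    linarith
  have hq : 0 ≤ ∫ t, 1 / p t := integral_nonneg_of_ae (by
    filter_upwards [hp] with t ht
    exact (one_div_pos.2 ht).le)
  have him : I.im = 0 := by
    have h1 : I.im * (1 + κ * ∫ t, 1 / p t) = 0 := by linear_combination h_int
    exact (mul_eq_zero.1 h1).resolve_right (by positivity)
  have hre : I = (I.re : ℂ) := Complex.ext rfl (by simpa using him)
  refine ⟨I.re, fun x => ⟨?_, ?_⟩⟩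
  · rw [primitiveL2_apply, ← integral_complex_ofReal]
    refine integral_congr_ae (ae_restrict_of_ae ?_)
    filter_upwards [h, hp] with t h2 h3
    have h4 : (p t : ℂ) ≠ 0 := by exact_mod_cast h3.ne'
    rw [hre] at h2
    push_cast
    field_simp
    linear_combination h2
  · rw [primitiveL2_one, inner_one, ← hI, ← hre]

/-- With `f = (Ku)'`, the weak equation becomes the pointwise identity `p f + κ ∫ f = N`. It shows
that `Ku` is real and supplies the chain of integrals leading from `u` to `Ku`. -/
theorem K_real_and_signChanges_le {p : Lp ℝ ∞ (volume : Measure unitInterval)}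
    {r : Lp ℝ 1 (volume : Measure unitInterval)} {κ α β : ℝ}
    (hp : ∀ᵐ x : unitInterval, 0 < p x)
    (hp_inv : MemLp (fun x : unitInterval => 1 / p x) ∞ volume)
    (hr : ∀ᵐ x : unitInterval, 0 < r x) (hκ : 0 < κ) (hα : 0 ≤ α) (hβ : 0 < β) (u : D1)
    (hu : ∀ x, (D1fn u x).im = 0) :
    (∀ x, (D1fn (K p r κ α β u) x).im = 0) ∧
      signChanges (fun x => (D1fn (K p r κ α β u) x).re) ≤
        signChanges (fun x => (D1fn u x).re) := by
  obtain ⟨f, hf⟩ := primitiveEquiv.surjective (K p r κ α β u)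
  have hT := T_zero_Q_K p r κ α β (T_zero_isInvertible r κ α β hp hp_inv hκ) u
  rw [← hf] at hT ⊢
  set v : unitInterval → ℝ := fun x => (D1fn u x).re with hv
  have hvu : ∀ x, D1fn u x = v x := fun x => Complex.ext rfl (by simpa using hu x)
  have hvc : Continuous v := Complex.continuous_re.comp (D1fn u).continuous
  have hvi := integrable_of_continuous hvc
  set U : unitInterval → ℝ := fun x => ∫ t in Iic x, v t with hU
  have hUc : Continuous U := continuous_setIntegral_Iic hvi
  have hUu : ∀ x, primitive (D1fn u) x = U x := fun x => by
    rw [primitive_apply, hU, ← integral_complex_ofReal]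
    simp only [hvu]
  have hrU := integrable_continuous_mul hUc (L1.integrable_coeFn r)
  set S : unitInterval → ℝ := fun x => (∫ t in Ici x, U t * r t) + β * U 1 with hS
  have hSc : Continuous S := (continuous_setIntegral_Ici hrU).add continuous_const
  have hSi := integrable_of_continuous hSc
  set N : unitInterval → ℝ := fun x => (∫ t in Ici x, S t) + α * v 1 with hN
  have hNc : Continuous N := (continuous_setIntegral_Ici hSi).add continuous_const
  have hNL : MemLp (fun x => (N x : ℂ)) 2 (volume : Measure unitInterval) := by
    obtain ⟨C, hC⟩ := isCompact_univ.exists_bound_of_continuousOn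
      (Complex.continuous_ofReal.comp hNc).continuousOn
    exact MemLp.of_bound (Complex.continuous_ofReal.comp hNc).aestronglyMeasurable C
      (Filter.Eventually.of_forall fun t => hC t (mem_univ t))
  -- Second derivatives of test functions in `D` exhaust `L2`, so the weak equation is an identity
  -- in `L2`.
  have hweak : (p • f : L2) + ((κ : ℂ) * inner ℂ one f) • one = hNL.toLp _ := by
    refine ext_inner_left ℂ fun g => ?_
    rw [← T_zero_primitive2 p r κ α β]
    refine (congrArg (fun φ : DDual => φ (primitive2 g)) hT).trans ?_
    change loadForm r α β (primitive (D1fn u), D1fn u 1) (primitive2 g) = _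
    rw [loadForm_primitive2 r α β hUu (hvu 1) hrU (fun x => rfl) hSc, L2.inner_def]
    refine integral_congr_ae ?_
    filter_upwards [hNL.coeFn_toLp] with t ht
    rw [ht, RCLike.inner_apply]
  have hae : ∀ᵐ t, (p t : ℂ) * f t + κ * ∫ s, f s = N t := by
    have h1 := hNL.coeFn_toLp
    rw [← hweak] at h1
    filter_upwards [h1, Lp.coeFn_add (p • f : L2) (((κ : ℂ) * inner ℂ one f) • one),
      Lp.coeFn_lpSMul (r := 2) p f, Lp.coeFn_smul ((κ : ℂ) * inner ℂ one f) one,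
      coeFn_one] with t h1 h2 h3 h4 h5
    rw [← h1, h2, Pi.add_apply, h3, h4, Pi.smul_apply', Pi.smul_apply, h5, inner_one]
    simp
  obtain ⟨Y, hY⟩ := exists_real_of_smul_add_eq hp hκ hae
  have hfn : ∀ x, D1fn (primitiveEquiv f) x =
      (∫ t in Iic x, (N t - κ * Y) * (1 / p t) : ℝ) := fun x => (hY x).1
  refine ⟨fun x => by rw [hfn, Complex.ofReal_im], ?_⟩
  have hre : ∀ x, (D1fn (primitiveEquiv f) x).re = ∫ t in Iic x, (N t - κ * Y) * (1 / p t) :=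
    fun x => by rw [hfn, Complex.ofReal_re]
  have hY1 : (D1fn (primitiveEquiv f) 1).re = Y := congrArg Complex.re (hY 1).2
  -- The term `κ y(1) = κ Y` moves into the boundary constant of `N`, so that `y' = N/p` and the
  -- relation `c + κ y(1) = α u(1)` holds by the choice of `c`.
  refine signChanges_le_of_integral (U := U) (S := S) (N := fun t => N t - κ * Y)
    (q := fun t => 1 / p t) (c := α * v 1 - κ * Y) hr ?_ hκ hα hβ hvi (fun x => rfl) hrU
    (fun x => rfl) hSi (fun x => ?_) ?_ hre ?_
  · filter_upwards [hp] with t ht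
    exact one_div_pos.2 ht
  · simp only [hN]
    ring
  · exact integrable_continuous_mul (hNc.sub continuous_const) (hp_inv.integrable le_top)
  · rw [hY1]
    ring

end

end BeamPencil

theorem mainTheorem3
    (p : MeasureTheory.Lp ℝ ⊤ (MeasureTheory.volume : MeasureTheory.Measure unitInterval))
    (r : MeasureTheory.Lp ℝ 1 (MeasureTheory.volume : MeasureTheory.Measure unitInterval))
    (κ α β : ℝ)
    (hp : ∀ᵐ x : unitInterval, 0 < p x)
    (hp_inv : MeasureTheory.MemLp (fun x : unitInterval => 1 / p x) ⊤ MeasureTheory.volume)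
    (hr : ∀ᵐ x : unitInterval, 0 < r x)
    (hκ : 0 < κ) (hα : 0 ≤ α) (hβ : 0 < β) :
    (BeamPencil.T p r κ α β 0).IsInvertible ∧
    IsCompactOperator (BeamPencil.K p r κ α β) ∧
    ∀ u : BeamPencil.D1, (∀ x, (BeamPencil.D1fn u x).im = 0) →
      (∀ x, (BeamPencil.D1fn (BeamPencil.K p r κ α β u) x).im = 0) ∧
      BeamPencil.signChanges (fun x => (BeamPencil.D1fn (BeamPencil.K p r κ α β u) x).re) ≤
        BeamPencil.signChanges (fun x => (BeamPencil.D1fn u x).re) := by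
  exact ⟨BeamPencil.T_zero_isInvertible r κ α β hp hp_inv hκ,
    BeamPencil.isCompactOperator_K p r κ α β,
    fun u hu => BeamPencil.K_real_and_signChanges_le hp hp_inv hr hκ hα hβ u hu⟩
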